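/- Let $(\Omega,\lambda)$ be an atomless probability space, that is, every measurable set of positive measure contains a measurable subset of strictly smaller positive measure. For $n\ge 0$ let $[n]=\{0,\dots,n\}$ and let $\triangledown_n=L^1(\Omega,[n])$ be the set of measurable maps $\Omega\to[n]$ up to almost everywhere equality, endowed with the topology of the metric $d(f,g)=\int_\Omega d(f(\omega),g(\omega))\,d\lambda(\omega)=\lambda(\{f\neq g\})$, where $[n]$ has the discrete metric (this is the topology of convergence in probability). A weakly increasing map $\sigma:[m]\to[n]$ induces $\triangledown(\sigma):\triangledown_m\to\triangledown_n$, $f\mapsto\sigma\circ f$. For a simplicial set $F$ with sets of simplices $F_n$, considered as discrete spaces, the randomized realization $L(F)$ is the quotient space of $\bigsqcup_{n\ge 0} F_n\times\triangledown_n$ by the equivalence relation generated by $(\alpha\sigma,a)\sim(\alpha,\triangledown(\sigma)(a))$ for all weakly increasing $\sigma:[m]\to[n]$, $\alpha\in F_n$ and $a\in\triangledown_m$. **Proposition.** For every simplicial set $F$, the space $L(F)$ is paracompact (in particular Hausdorff), perfectly normal (every closed subset is the zero set of some continuous function $L(F)\to[0,\infty)$) and compactly generated. -/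

import Mathlib

open CategoryTheory MeasureTheory
open scoped Simplicial

universe u v

noncomputable section

/-- A measure is atomless when every measurable set of positive measure contains a measurable
subset of strictly smaller positive measure. -/
def Atomless {Ω : Type*} [MeasurableSpace Ω] (μ : Measure Ω) : Prop :=
  ∀ A : Set Ω, MeasurableSet A → 0 < μ A →
    ∃ B : Set Ω, B ⊆ A ∧ MeasurableSet B ∧ 0 < μ B ∧ μ B < μ A

/-- The space `L¹(Ω, [n])` of random variables on `(Ω, μ)` with values in the discrete space
`[n] = {0, …, n}`, up to almost everywhere equality. -/
def RandomSimplex {Ω : Type*} [MeasurableSpace Ω] (μ : Measure Ω) (n : ℕ) : Type _ :=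
  Ω →ₘ[μ] Fin (n + 1)

namespace RandomSimplex

variable {Ω : Type*} [MeasurableSpace Ω] {μ : Measure Ω}

/-- A measurable representative of a random variable. -/
def rep {n : ℕ} (f : RandomSimplex μ n) : Ω → Fin (n + 1) :=
  ((show Ω →ₘ[μ] Fin (n + 1) from f) : Ω → Fin (n + 1))

theorem integrable_discrepancy {n : ℕ} [IsFiniteMeasure μ] (f g : RandomSimplex μ n) :
    Integrable (fun ω => if f.rep ω = g.rep ω then (0 : ℝ) else 1) μ := by
  refine Integrable.of_bound (C := 1) (Measurable.aestronglyMeasurable ?_) ?_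
  · exact Measurable.ite
      (measurableSet_eq_fun (AEEqFun.measurable _) (AEEqFun.measurable _))
      measurable_const measurable_const
  · refine Filter.Eventually.of_forall fun ω => ?_
    split_ifs <;> simp

/-- The `L¹` metric attached to the discrete metric of `[n]`: the distance of `f` and `g` is the
integral of the function `ω ↦ d(f ω, g ω)`, which is `0` where `f ω = g ω` and `1` elsewhere. Its
topology is that of convergence in probability. -/
instance (n : ℕ) [IsFiniteMeasure μ] : MetricSpace (RandomSimplex μ n) where
  dist f g := ∫ ω, (if f.rep ω = g.rep ω then (0 : ℝ) else 1) ∂μ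
  dist_self f := by simp
  dist_comm f g := by simp only [eq_comm]
  dist_triangle f g h := by
    have hm := integrable_discrepancy (μ := μ) (n := n)
    rw [← integral_add (hm f g) (hm g h)]
    refine integral_mono (hm f h) ((hm f g).add (hm g h)) fun ω => ?_
    by_cases h1 : f.rep ω = g.rep ω <;> by_cases h2 : g.rep ω = h.rep ω <;>
      by_cases h3 : f.rep ω = h.rep ω <;> simp_all
  eq_of_dist_eq_zero := by
    intro f g hfg
    have h0 := (integral_eq_zero_iff_of_nonneg
      (fun ω => by split_ifs <;> simp) (integrable_discrepancy f g)).1 hfg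
    refine AEEqFun.ext (h0.mono fun ω hω => ?_)
    by_contra hne
    have hne' : ¬ f.rep ω = g.rep ω := hne
    simp [hne'] at hω

/-- A weakly increasing map `σ : [m] → [n]` sends the random variable `f` to `σ ∘ f`. -/
def map {m n : ℕ} (σ : ⦋m⦌ ⟶ ⦋n⦌) (f : RandomSimplex μ m) : RandomSimplex μ n :=
  AEEqFun.comp (fun i : Fin (m + 1) => (σ.toOrderHom i : Fin (n + 1)))
    continuous_of_discreteTopology f

end RandomSimplex

/-- The disjoint union over `n` of the sets `F_n × L¹(Ω, [n])`. -/
def RandomCells {Ω : Type v} [MeasurableSpace Ω] (μ : Measure Ω) (F : SSet.{u}) : Type (max u v) :=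
  Σ n : ℕ, F.obj (Opposite.op ⦋n⦌) × RandomSimplex μ n

/-- The topology of the disjoint union of the products `F_n × L¹(Ω, [n])`, the set `F_n` of
`n`-simplices being discrete. -/
instance {Ω : Type v} [MeasurableSpace Ω] (μ : Measure Ω) [IsFiniteMeasure μ] (F : SSet.{u}) :
    TopologicalSpace (RandomCells μ F) :=
  letI : ∀ n : ℕ, TopologicalSpace (F.obj (Opposite.op ⦋n⦌)) := fun _ => ⊥
  inferInstanceAs (TopologicalSpace (Σ n : ℕ, F.obj (Opposite.op ⦋n⦌) × RandomSimplex μ n))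

/-- The relations `(α σ, a) ∼ (α, σ ∘ a)`. -/
inductive RandomRel {Ω : Type v} [MeasurableSpace Ω] (μ : Measure Ω) (F : SSet.{u}) :
    RandomCells μ F → RandomCells μ F → Prop where
  | glue {m n : ℕ} (σ : ⦋m⦌ ⟶ ⦋n⦌) (α : F.obj (Opposite.op ⦋n⦌)) (a : RandomSimplex μ m) :
      RandomRel μ F ⟨m, (F.map σ.op α, a)⟩ ⟨n, (α, a.map σ)⟩

/-- The randomized realization `L(F)`: the quotient of the disjoint union of the
`F_n × L¹(Ω, [n])` by the equivalence relation generated by `(α σ, a) ∼ (α, σ ∘ a)`. -/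
def RandomRealization {Ω : Type v} [MeasurableSpace Ω] (μ : Measure Ω) (F : SSet.{u}) :
    Type (max u v) :=
  _root_.Quotient (Relation.EqvGen.setoid (RandomRel μ F))

/-- `L(F)` carries the quotient topology. -/
instance {Ω : Type v} [MeasurableSpace Ω] (μ : Measure Ω) [IsFiniteMeasure μ] (F : SSet.{u}) :
    TopologicalSpace (RandomRealization μ F) :=
  inferInstanceAs (TopologicalSpace (_root_.Quotient (Relation.EqvGen.setoid (RandomRel μ F))))

end

/-!
The randomized realization `L(F)` is built like a CW complex, with the metric spaces `L¹(Ω, [n])` in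
the role of the simplices.

A random variable with values in `[n]` is *full* if it takes every value with positive probability.
Every random variable factors uniquely as a full one followed by an injective weakly increasing map.
Together with the Eilenberg–Zilber lemma for `F` this gives every point of `L(F)` a normal form: a
nondegenerate simplex of `F` and a full random variable (`Reduces.unique`,
`reduces_iff_of_eqvGen`). Hence `L(F)` is presented by cells indexed by the nondegenerate simplices,
and the boundary of a cell, consisting of the random variables that are not full, is a
finite union of closed faces, each mapped through a cell of smaller dimension
(`RandomRealization.metricCells`).

For any space with such a presentation `MetricCells`, a function can be constructed one dimension at
a time, by extending it from the closed boundary of each cell to the cell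
(`MetricCells.exists_of_extension`). By Tietze's theorem, a nonnegative function on a boundary whose
zero set is the trace of a given closed set `C` extends to one on the cell with zero set the trace
of `C`, so every closed set is a zero set. Points are closed, so the space is Hausdorff. For
paracompactness, nonnegative functions `φ i`, positive at most on the members `U i` of a given
open cover, without common zero, and with locally finite supports on each cell, are constructed in
the same manner. Their supports need not be locally finite on the whole space, but the sets where
`φ i` exceeds `(∑ φ i ^ 2) / (2 * ∑ φ i)` are (`MetricCells.paracompactSpace`), and they refine the
cover. With this and the zero sets, the space is perfectly normal. Finally `L(F)` is compactly
generated because it is a quotient of a first countable space, hence sequential.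
-/

noncomputable section

open Set Topology

/-! ### Extending functions from closed subsets -/

section Extension

variable {D : Type*} [MetricSpace D]

theorem exists_continuous_nonneg_zero_iff {A : Set D} (hA : IsClosed A) :
    ∃ h : D → ℝ, Continuous h ∧ (∀ x, 0 ≤ h x) ∧ ∀ x, h x = 0 ↔ x ∈ A := by
  rcases A.eq_empty_or_nonempty with rfl | hne
  · exact ⟨fun _ => 1, continuous_const, fun _ => zero_le_one, by simp⟩
  · exact ⟨fun x => Metric.infDist x A, Metric.continuous_infDist_pt A,
      fun _ => Metric.infDist_nonneg, fun x => (hA.mem_iff_infDist_zero hne).symm⟩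

/-- Tietze's theorem for a nonnegative function, with an extension that vanishes on `Z`. -/
theorem exists_continuous_extension_eq_zero {B Z : Set D} (hB : IsClosed B) (hZ : IsClosed Z)
    {f : D → ℝ} (hf : ContinuousOn f B) (hpos : ∀ x ∈ B, 0 ≤ f x)
    (hzero : ∀ x ∈ B, x ∈ Z → f x = 0) :
    ∃ g : D → ℝ, Continuous g ∧ (∀ x, 0 ≤ g x) ∧ (∀ x ∈ B, g x = f x) ∧ ∀ x ∈ Z, g x = 0 := by
  classical
  let F : D → ℝ := fun x => if x ∈ Z then 0 else f x
  have hFB : EqOn F f B := fun x hx => by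
    by_cases hxZ : x ∈ Z
    · simp [F, hxZ, hzero x hx hxZ]
    · simp [F, hxZ]
  have hFZ : EqOn F (fun _ => 0) Z := fun x hx => by simp [F, hx]
  have hF : ContinuousOn F (B ∪ Z) :=
    (hf.congr hFB).union_of_isClosed (continuousOn_const.congr hFZ) hB hZ
  obtain ⟨g, hg⟩ := ContinuousMap.exists_restrict_eq (hB.union hZ)
    (⟨(B ∪ Z).domRestrict F, hF.domRestrict⟩ : C((B ∪ Z : Set D), ℝ))
  have hg' : ∀ x ∈ B ∪ Z, g x = F x := fun x hx => by
    exact congrArg (fun k : C((B ∪ Z : Set D), ℝ) => k ⟨x, hx⟩) hg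
  refine ⟨fun x => |g x|, g.continuous.abs, fun x => abs_nonneg _, fun x hx => ?_, fun x hx => ?_⟩
  · simp only [hg' x (Or.inl hx), hFB hx, abs_of_nonneg (hpos x hx)]
  · simp only [hg' x (Or.inr hx), hFZ hx, abs_zero]

theorem exists_continuous_extension_zero_iff {B C : Set D} (hB : IsClosed B) (hC : IsClosed C)
    {f : D → ℝ} (hf : ContinuousOn f B) (hpos : ∀ x ∈ B, 0 ≤ f x)
    (hzero : ∀ x ∈ B, f x = 0 ↔ x ∈ C) :
    ∃ g : D → ℝ, (Continuous g ∧ (∀ x, 0 ≤ g x) ∧ ∀ x, g x = 0 ↔ x ∈ C) ∧ ∀ x ∈ B, g x = f x := by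
  obtain ⟨g, hgc, hg0, hgB, hgC⟩ := exists_continuous_extension_eq_zero hB hC hf hpos
    fun x hx => (hzero x hx).2
  obtain ⟨h, hhc, hh0, hh⟩ := exists_continuous_nonneg_zero_iff (hB.union hC)
  refine ⟨fun x => g x + h x, ⟨hgc.add hhc, fun x => add_nonneg (hg0 x) (hh0 x), fun x => ?_⟩,
    fun x hx => ?_⟩
  · rw [add_eq_zero_iff_of_nonneg (hg0 x) (hh0 x), hh]
    constructor
    · rintro ⟨h1, h2 | h2⟩
      · rwa [hgB x h2, hzero x h2] at h1
      · exact h2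
    · exact fun hx => ⟨hgC x hx, Or.inr hx⟩
  · simp [(hh x).2 (Or.inl hx), hgB x hx]

theorem LocallyFinite.union {X I : Type*} [TopologicalSpace X] {f g : I → Set X}
    (hf : LocallyFinite f) (hg : LocallyFinite g) : LocallyFinite fun i => f i ∪ g i := by
  intro x
  obtain ⟨s, hs, hsf⟩ := hf x
  obtain ⟨t, ht, htf⟩ := hg x
  refine ⟨s ∩ t, Filter.inter_mem hs ht, (hsf.union htf).subset ?_⟩
  rintro i ⟨y, hy | hy, hys, hyt⟩
  · exact Or.inl ⟨y, hy, hys⟩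
  · exact Or.inr ⟨y, hy, hyt⟩

theorem LocallyFinite.iUnion_of_finite {X I K : Type*} [TopologicalSpace X] [Finite K]
    {f : K → I → Set X} (hf : ∀ k, LocallyFinite (f k)) : LocallyFinite fun i => ⋃ k, f k i := by
  intro x
  choose s hs hsf using fun k => hf k x
  refine ⟨⋂ k, s k, Filter.iInter_mem.2 hs, (Set.finite_iUnion hsf).subset ?_⟩
  rintro i ⟨y, hy, hys⟩
  obtain ⟨k, hk⟩ := mem_iUnion.1 hy
  exact mem_iUnion.2 ⟨k, y, hk, mem_iInter.1 hys k⟩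

/-- In a paracompact space a locally finite family of sets can be enlarged to a locally finite
family of open sets: delete from the whole space the members of a fine enough locally finite closed
cover that do not meet the given set. -/
theorem LocallyFinite.exists_isOpen_superset {X I : Type*} [TopologicalSpace X] [NormalSpace X]
    [ParacompactSpace X] {W : I → Set X} (hW : LocallyFinite W) :
    ∃ O : I → Set X, (∀ i, IsOpen (O i)) ∧ LocallyFinite O ∧ ∀ i, W i ⊆ O i := by
  choose N hN hfin using hW
  obtain ⟨V, hVo, hVc, hVf, hVN⟩ := precise_refinement (fun x => interior (N x))
    (fun _ => isOpen_interior)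
    (eq_univ_of_forall fun x => mem_iUnion.2 ⟨x, mem_interior_iff_mem_nhds.2 (hN x)⟩)
  obtain ⟨T, hTc, -, hTV⟩ := exists_iUnion_eq_closure_subset hVo hVf.point_finite hVc
  have hTV' : ∀ k, closure (T k) ⊆ N k := fun k =>
    (hTV k).trans ((hVN k).trans interior_subset)
  have hTf : LocallyFinite fun k => closure (T k) := hVf.subset hTV
  refine ⟨fun i => (⋃ k : {k // closure (T k) ∩ W i = ∅}, closure (T k.1))ᶜ, fun i => ?_, ?_, ?_⟩
  · exact ((hTf.comp_injective Subtype.val_injective).isClosed_iUnion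
      fun _ => isClosed_closure).isOpen_compl
  · intro x
    obtain ⟨s, hs, hsf⟩ := hTf x
    refine ⟨s, hs, (hsf.biUnion fun k _ => hfin k).subset ?_⟩
    rintro i ⟨y, hyO, hys⟩
    obtain ⟨k, hk⟩ := mem_iUnion.1 (hTc.symm ▸ mem_univ y : y ∈ ⋃ k, T k)
    have hne : (closure (T k) ∩ W i).Nonempty := by
      by_contra h
      exact hyO (mem_iUnion.2 ⟨⟨k, not_nonempty_iff_eq_empty.1 h⟩, subset_closure hk⟩)
    obtain ⟨z, hz, hzW⟩ := hne
    exact mem_biUnion (show k ∈ {k | (closure (T k) ∩ s).Nonempty} from ⟨y, subset_closure hk, hys⟩)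
      ⟨z, hzW, hTV' k hz⟩
  · intro i x hx hx'
    obtain ⟨⟨k, hk⟩, hxk⟩ := mem_iUnion.1 hx'
    exact (hk ▸ (⟨hxk, hx⟩ : x ∈ closure (T k) ∩ W i) : x ∈ (∅ : Set X))

/-- A family `φ` of nonnegative continuous functions, with locally finite supports, without common
zero, and with `φ i` positive at most on `U i`. -/
structure IsSubordinateFamily {X I : Type*} [TopologicalSpace X] (U : I → Set X)
    (φ : X → I → ℝ) : Prop where
  continuous : ∀ i, Continuous fun x => φ x i
  nonneg : ∀ x i, 0 ≤ φ x i
  locallyFinite : LocallyFinite fun i => {x | φ x i ≠ 0}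
  mem : ∀ x i, φ x i ≠ 0 → x ∈ U i
  exists_ne : ∀ x, ∃ i, φ x i ≠ 0

/-- Subordinate families extend from closed subsets of metric spaces. The functions are extended
one by one, to functions that vanish off a locally finite family of open sets; a partition of unity,
multiplied by a function that vanishes exactly on `B`, is added to remove the common zeros. -/
theorem exists_isSubordinateFamily_extension {I : Type*} {B : Set D} (hB : IsClosed B)
    {U : I → Set D} (hU : ∀ i, IsOpen (U i)) (hUc : ⋃ i, U i = univ) {φ : D → I → ℝ}
    (hc : ∀ i, ContinuousOn (fun x => φ x i) B) (hpos : ∀ x ∈ B, ∀ i, 0 ≤ φ x i)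
    (hlf : LocallyFinite fun i => B ∩ {x | φ x i ≠ 0})
    (hmem : ∀ x ∈ B, ∀ i, φ x i ≠ 0 → x ∈ U i) (hne : ∀ x ∈ B, ∃ i, φ x i ≠ 0) :
    ∃ ψ : D → I → ℝ, IsSubordinateFamily U ψ ∧ ∀ x ∈ B, ψ x = φ x := by
  obtain ⟨O, hO, hOf, hOW⟩ := hlf.exists_isOpen_superset
  have key : ∀ i, ∃ g : D → ℝ, Continuous g ∧ (∀ x, 0 ≤ g x) ∧ (∀ x ∈ B, g x = φ x i) ∧
      ∀ x ∈ (O i ∩ U i)ᶜ, g x = 0 := fun i => by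
    refine exists_continuous_extension_eq_zero hB ((hO i).inter (hU i)).isClosed_compl (hc i)
      (fun x hx => hpos x hx i) fun x hx hx' => ?_
    by_contra h
    exact hx' ⟨hOW i ⟨hx, h⟩, hmem x hx i h⟩
  choose g hgc hg0 hgB hgZ using key
  have hgZ' : ∀ x i, g i x ≠ 0 → x ∈ O i ∩ U i := fun x i h => by
    by_contra h'
    exact h (hgZ i x h')
  obtain ⟨ρ, hρ⟩ := PartitionOfUnity.exists_isSubordinate isClosed_univ U hU hUc.ge
  obtain ⟨h, hhc, hh0, hh⟩ := exists_continuous_nonneg_zero_iff hB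
  have hsum0 : ∀ x i, g i x + h x * ρ i x ≠ 0 ↔ g i x ≠ 0 ∨ (h x ≠ 0 ∧ ρ i x ≠ 0) := by
    intro x i
    rw [Ne, add_eq_zero_iff_of_nonneg (hg0 i x) (mul_nonneg (hh0 x) (ρ.nonneg i x)), mul_eq_zero]
    tauto
  refine ⟨fun x i => g i x + h x * ρ i x, ⟨fun i => ?_, fun x i => ?_, ?_, fun x i hx => ?_,
    fun x => ?_⟩, fun x hx => ?_⟩
  · exact (hgc i).add (hhc.mul (ρ i).continuous)
  · exact add_nonneg (hg0 i x) (mul_nonneg (hh0 x) (ρ.nonneg i x))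
  · refine (hOf.union ρ.locallyFinite).subset fun i x hx => ?_
    exact ((hsum0 x i).1 hx).imp (fun h' => (hgZ' x i h').1) fun h' => h'.2
  · rcases (hsum0 x i).1 hx with h' | h'
    · exact (hgZ' x i h').2
    · exact hρ i (subset_tsupport _ h'.2)
  · by_cases hx : x ∈ B
    · obtain ⟨i, hi⟩ := hne x hx
      exact ⟨i, (hsum0 x i).2 (Or.inl (by rwa [hgB i x hx]))⟩
    · obtain ⟨i, hi⟩ := ρ.exists_pos (mem_univ x)
      exact ⟨i, (hsum0 x i).2 (Or.inr ⟨fun h0 => hx ((hh x).1 h0), hi.ne'⟩)⟩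
  · funext i
    simp [(hh x).2 hx, hgB i x hx]

end Extension

/-! ### Spaces built from metric cells -/

set_option linter.checkUnivs false in
/-- A presentation of the space `X` by cells that are metric spaces: every cell `j` has a dimension,
a domain `Dom j`, a subset `bdry j` of it and a characteristic map `char j : Dom j → X`. Every
point of `X` is the image of exactly one point in the complement of a boundary, `X` carries the
final topology, and the boundary of a cell is a finite union of closed sets, its faces, on each of
which the characteristic map factors continuously through that of a cell of smaller dimension.
The maps `h c` in this factorization are defined on all of `Dom j`, the factorization holds on the
face `C c`. -/
structure MetricCells (X : Type*) [TopologicalSpace X] where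
  Cell : Type*
  dim : Cell → ℕ
  Dom : Cell → Type*
  [metric : ∀ j, MetricSpace (Dom j)]
  bdry : ∀ j, Set (Dom j)
  char : ∀ j, Dom j → X
  continuous_char : ∀ j, Continuous (char j)
  isClosed_of_preimage : ∀ s : Set X, (∀ j, IsClosed (char j ⁻¹' s)) → IsClosed s
  surjective : ∀ x, ∃ j d, char j d = x
  injective : ∀ p q : Σ j, Dom j, p.2 ∉ bdry p.1 → q.2 ∉ bdry q.1 →
    char p.1 p.2 = char q.1 q.2 → p = q
  exists_faces : ∀ j, ∃ (K : Type) (_ : Finite K) (C : K → Set (Dom j)) (t : K → Cell)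
    (h : ∀ c, Dom j → Dom (t c)), bdry j = ⋃ c, C c ∧ ∀ c, IsClosed (C c) ∧ dim (t c) < dim j ∧
      Continuous (h c) ∧ ∀ d ∈ C c, char j d = char (t c) (h c d)

namespace MetricCells

attribute [instance] MetricCells.metric

variable {X : Type*} [TopologicalSpace X] (S : MetricCells X)

theorem exists_of_mem_bdry {j : S.Cell} {d : S.Dom j} (hd : d ∈ S.bdry j) :
    ∃ (j' : S.Cell) (d' : S.Dom j'), S.dim j' < S.dim j ∧ S.char j' d' = S.char j d := by
  obtain ⟨K, _, C, t, h, hb, hC⟩ := S.exists_faces j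
  rw [hb] at hd
  obtain ⟨c, hc⟩ := mem_iUnion.1 hd
  exact ⟨t c, h c d, (hC c).2.1, ((hC c).2.2.2 d hc).symm⟩

theorem exists_interior_le (j : S.Cell) (d : S.Dom j) :
    ∃ p : Σ j, S.Dom j, p.2 ∉ S.bdry p.1 ∧ S.char p.1 p.2 = S.char j d ∧ S.dim p.1 ≤ S.dim j := by
  induction hn : S.dim j using Nat.strong_induction_on generalizing j with
  | _ n ih =>
    by_cases hd : d ∈ S.bdry j
    · obtain ⟨j', d', hlt, he⟩ := S.exists_of_mem_bdry hd
      obtain ⟨p, hp, hpe, hple⟩ := ih _ (hn ▸ hlt) j' d' rfl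
      exact ⟨p, hp, hpe.trans he, hple.trans (hn ▸ hlt.le)⟩
    · exact ⟨⟨j, d⟩, hd, rfl, hn.le⟩

theorem exists_interior (x : X) :
    ∃ p : Σ j, S.Dom j, p.2 ∉ S.bdry p.1 ∧ S.char p.1 p.2 = x := by
  obtain ⟨j, d, rfl⟩ := S.surjective x
  obtain ⟨p, hp, hpe, -⟩ := S.exists_interior_le j d
  exact ⟨p, hp, hpe⟩

/-- The unique pair of a cell and a point off its boundary that represents `x`. -/
def point (x : X) : Σ j, S.Dom j := (S.exists_interior x).choose

theorem point_notMem (x : X) : (S.point x).2 ∉ S.bdry (S.point x).1 :=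
  (S.exists_interior x).choose_spec.1

theorem char_point (x : X) : S.char (S.point x).1 (S.point x).2 = x :=
  (S.exists_interior x).choose_spec.2

theorem point_char {j : S.Cell} {d : S.Dom j} (hd : d ∉ S.bdry j) :
    S.point (S.char j d) = ⟨j, d⟩ :=
  S.injective _ ⟨j, d⟩ (S.point_notMem _) hd (S.char_point _)

/-- The dimension of the cell that contains `x` off its boundary. -/
def pointDim (x : X) : ℕ := S.dim (S.point x).1

theorem pointDim_char {j : S.Cell} {d : S.Dom j} (hd : d ∉ S.bdry j) :
    S.pointDim (S.char j d) = S.dim j := by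
  rw [pointDim, S.point_char hd]

theorem pointDim_char_le (j : S.Cell) (d : S.Dom j) : S.pointDim (S.char j d) ≤ S.dim j := by
  obtain ⟨p, hp, hpe, hple⟩ := S.exists_interior_le j d
  rwa [← hpe, S.pointDim_char hp]

theorem pointDim_char_lt {j : S.Cell} {d : S.Dom j} (hd : d ∈ S.bdry j) :
    S.pointDim (S.char j d) < S.dim j := by
  obtain ⟨j', d', hlt, he⟩ := S.exists_of_mem_bdry hd
  exact he ▸ (S.pointDim_char_le j' d').trans_lt hlt

/-- Construction of functions on `X` by induction on the dimension of the cells: if functions with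
the property `P` can be extended from the boundary of every cell to the whole cell, then there is a
function on `X` that has the property on all cells. -/
theorem exists_of_extension {V : Type*} [Nonempty V] (P : ∀ j, (S.Dom j → V) → Prop)
    (H : ∀ (j : S.Cell) (f : X → V),
      (∀ j', S.dim j' < S.dim j → P j' fun d => f (S.char j' d)) →
      ∃ g : S.Dom j → V, P j g ∧ ∀ d ∈ S.bdry j, g d = f (S.char j d)) :
    ∃ f : X → V, ∀ j, P j fun d => f (S.char j d) := by
  classical
  let Q : ℕ → (X → V) → Prop := fun n f => ∀ j, S.dim j < n → P j fun d => f (S.char j d)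
  have step : ∀ (n : ℕ) (f : {f // Q n f}),
      ∃ f' : {f' // Q (n + 1) f'}, ∀ x, S.pointDim x < n → f'.1 x = f.1 x := by
    rintro n ⟨f, hf⟩
    choose g hgP hgB using fun (j : S.Cell) (hj : S.dim j = n) => H j f fun j' h => hf j' (hj ▸ h)
    let f' : X → V := fun x =>
      if h : S.dim (S.point x).1 = n then g (S.point x).1 h (S.point x).2 else f x
    have hlow : ∀ x, S.pointDim x < n → f' x = f x := fun x hx => dif_neg hx.ne
    refine ⟨⟨f', fun j hj => ?_⟩, hlow⟩
    rcases (Nat.lt_succ_iff.1 hj).lt_or_eq with hj | hj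
    · have : (fun d => f' (S.char j d)) = fun d => f (S.char j d) :=
        funext fun d => hlow _ ((S.pointDim_char_le j d).trans_lt hj)
      rw [this]
      exact hf j hj
    · have : (fun d => f' (S.char j d)) = g j hj := by
        funext d
        by_cases hd : d ∈ S.bdry j
        · rw [hgB j hj d hd]
          exact hlow _ (hj ▸ S.pointDim_char_lt hd)
        · have hval : ∀ p : Σ j, S.Dom j, p = ⟨j, d⟩ →
              (if h : S.dim p.1 = n then g p.1 h p.2 else f (S.char j d)) = g j hj d := by
            rintro p rfl
            exact dif_pos hj
          exact hval _ (S.point_char hd)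
      rw [this]
      exact hgP j hj
  choose next hnext using step
  let F : ∀ n, {f // Q n f} := fun n =>
    Nat.rec ⟨fun _ => Classical.arbitrary V, fun _ h => absurd h (Nat.not_lt_zero _)⟩
      (fun n f => next n f) n
  have hF : ∀ n x, S.pointDim x < n → (F (n + 1)).1 x = (F n).1 x := fun n x hx =>
    hnext n (F n) x hx
  have hstab : ∀ x n, S.pointDim x < n → (F n).1 x = (F (S.pointDim x + 1)).1 x := by
    intro x n hn
    induction n, Nat.succ_le_of_lt hn using Nat.le_induction with
    | base => rfl
    | succ m hm ih => rw [hF m x hm, ih hm]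
  refine ⟨fun x => (F (S.pointDim x + 1)).1 x, fun j => ?_⟩
  have : (fun d => (F (S.pointDim (S.char j d) + 1)).1 (S.char j d)) =
      fun d => (F (S.dim j + 1)).1 (S.char j d) :=
    funext fun d => (hstab _ _ (Nat.lt_succ_of_le (S.pointDim_char_le j d))).symm
  rw [this]
  exact (F (S.dim j + 1)).2 j (Nat.lt_succ_self _)

theorem isClosed_bdry (j : S.Cell) : IsClosed (S.bdry j) := by
  obtain ⟨K, _, C, t, h, hb, hC⟩ := S.exists_faces j
  rw [hb]
  exact isClosed_iUnion_of_finite fun c => (hC c).1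

theorem continuous_of_char {Y : Type*} [TopologicalSpace Y] {f : X → Y}
    (hf : ∀ j, Continuous fun d => f (S.char j d)) : Continuous f :=
  continuous_iff_isClosed.2 fun _ hs => S.isClosed_of_preimage _ fun j => hs.preimage (hf j)

theorem isClosed_bdry_inter {j : S.Cell} {s : Set X}
    (hs : ∀ j', S.dim j' < S.dim j → IsClosed (S.char j' ⁻¹' s)) :
    IsClosed (S.bdry j ∩ S.char j ⁻¹' s) := by
  obtain ⟨K, _, C, t, h, hb, hC⟩ := S.exists_faces j
  have : S.bdry j ∩ S.char j ⁻¹' s = ⋃ c, C c ∩ h c ⁻¹' (S.char (t c) ⁻¹' s) := by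
    rw [hb, iUnion_inter]
    refine iUnion_congr fun c => ext fun d => and_congr_right fun hd => ?_
    rw [mem_preimage, mem_preimage, mem_preimage, (hC c).2.2.2 d hd]
  rw [this]
  exact isClosed_iUnion_of_finite fun c =>
    (hC c).1.inter ((hs _ (hC c).2.1).preimage (hC c).2.2.1)

theorem continuousOn_bdry {Y : Type*} [TopologicalSpace Y] {j : S.Cell} {f : X → Y}
    (hf : ∀ j', S.dim j' < S.dim j → Continuous fun d => f (S.char j' d)) :
    ContinuousOn (fun d => f (S.char j d)) (S.bdry j) := by
  obtain ⟨K, _, C, t, h, hb, hC⟩ := S.exists_faces j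
  rw [hb]
  refine (locallyFinite_of_finite C).continuousOn_iUnion (fun c => (hC c).1) fun c => ?_
  refine ((hf _ (hC c).2.1).comp (hC c).2.2.1).continuousOn.congr fun d hd => ?_
  simp [(hC c).2.2.2 d hd]

theorem locallyFinite_bdry {I : Type*} {j : S.Cell} {W : I → Set X}
    (hW : ∀ j', S.dim j' < S.dim j → LocallyFinite fun i => S.char j' ⁻¹' W i) :
    LocallyFinite fun i => S.bdry j ∩ S.char j ⁻¹' W i := by
  obtain ⟨K, _, C, t, h, hb, hC⟩ := S.exists_faces j
  refine (LocallyFinite.iUnion_of_finite fun c =>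
    (hW _ (hC c).2.1).preimage_continuous (hC c).2.2.1).subset fun i d hd => ?_
  rw [hb] at hd
  obtain ⟨c, hc⟩ := mem_iUnion.1 hd.1
  refine mem_iUnion.2 ⟨c, ?_⟩
  have := hd.2
  rwa [mem_preimage, (hC c).2.2.2 d hc] at this

theorem t1Space (S : MetricCells X) : T1Space X := by
  refine ⟨fun x => S.isClosed_of_preimage _ fun j => ?_⟩
  induction hn : S.dim j using Nat.strong_induction_on generalizing j with
  | _ n ih =>
    have hB : IsClosed (S.bdry j ∩ S.char j ⁻¹' {x}) :=
      S.isClosed_bdry_inter fun j' hj' => ih _ (hn ▸ hj') j' rfl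
    by_cases hx : ∃ d, d ∉ S.bdry j ∧ S.char j d = x
    · obtain ⟨d, hd, rfl⟩ := hx
      have : S.char j ⁻¹' {S.char j d} = (S.bdry j ∩ S.char j ⁻¹' {S.char j d}) ∪ {d} := by
        ext e
        constructor
        · intro he
          by_cases heB : e ∈ S.bdry j
          · exact Or.inl ⟨heB, he⟩
          · have h := S.injective ⟨j, e⟩ ⟨j, d⟩ heB hd he
            exact Or.inr (eq_of_heq (Sigma.mk.inj h).2)
        · rintro (he | rfl)
          · exact he.2
          · rfl
      rw [this]
      exact hB.union isClosed_singleton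
    · convert hB using 1
      refine (inter_eq_right.2 fun e he => ?_).symm
      by_contra heB
      exact hx ⟨e, heB, he⟩

theorem exists_continuous_zero_iff (S : MetricCells X) {C : Set X} (hC : IsClosed C) :
    ∃ f : X → ℝ, Continuous f ∧ (∀ x, 0 ≤ f x) ∧ ∀ x, f x = 0 ↔ x ∈ C := by
  obtain ⟨f, hf⟩ := S.exists_of_extension
    (fun j g => Continuous g ∧ (∀ d, 0 ≤ g d) ∧ ∀ d, g d = 0 ↔ d ∈ S.char j ⁻¹' C)
    fun j f hf => exists_continuous_extension_zero_iff (S.isClosed_bdry j)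
      (hC.preimage (S.continuous_char j)) (S.continuousOn_bdry fun j' hj' => (hf j' hj').1)
      (fun d hd => by
        obtain ⟨j', d', hlt, he⟩ := S.exists_of_mem_bdry hd
        exact he ▸ (hf j' hlt).2.1 d')
      (fun d hd => by
        obtain ⟨j', d', hlt, he⟩ := S.exists_of_mem_bdry hd
        rw [mem_preimage, ← he]
        exact (hf j' hlt).2.2 d')
  refine ⟨f, S.continuous_of_char fun j => (hf j).1, fun x => ?_, fun x => ?_⟩
  · obtain ⟨j, d, rfl⟩ := S.surjective x
    exact (hf j).2.1 d
  · obtain ⟨j, d, rfl⟩ := S.surjective x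
    exact (hf j).2.2 d

theorem t2Space (S : MetricCells X) : T2Space X := by
  have := S.t1Space
  refine ⟨fun x y hxy => ?_⟩
  obtain ⟨f, hfc, -, hf⟩ := S.exists_continuous_zero_iff (isClosed_singleton (x := x))
  exact separated_by_continuous hfc fun h => hxy ((hf y).1 (h ▸ (hf x).2 rfl)).symm

theorem exists_subordinate {I : Type*} {U : I → Set X} (hU : ∀ i, IsOpen (U i))
    (hUc : ⋃ i, U i = univ) : ∃ φ : X → I → ℝ, ∀ j,
      IsSubordinateFamily (fun i => S.char j ⁻¹' U i) fun d => φ (S.char j d) := by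
  refine S.exists_of_extension
    (fun j => IsSubordinateFamily fun i => S.char j ⁻¹' U i) fun j φ hφ => ?_
  refine exists_isSubordinateFamily_extension (S.isClosed_bdry j)
    (fun i => (hU i).preimage (S.continuous_char j)) (by rw [← preimage_iUnion, hUc, preimage_univ])
    (fun i => S.continuousOn_bdry (f := fun x => φ x i) fun j' hj' => (hφ j' hj').continuous i)
    (fun d hd => ?_)
    (S.locallyFinite_bdry (W := fun i => {x | φ x i ≠ 0}) fun j' hj' => (hφ j' hj').locallyFinite)
    (fun d hd => ?_) (fun d hd => ?_)
  all_goals obtain ⟨j', d', hlt, he⟩ := S.exists_of_mem_bdry hd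
  · exact he ▸ (hφ j' hlt).nonneg d'
  · simp only [mem_preimage, ← he]
    exact (hφ j' hlt).mem d'
  · exact he ▸ (hφ j' hlt).exists_ne d'

/-- The supports of a cellwise subordinate family `φ` need not be locally finite on `X`, because
local finiteness holds on one cell at a time. But the sum `s` of the `φ i` and the sum `q` of their
squares are continuous, and `q / s` is at most the largest `φ i`. The sets where `φ i` exceeds
`q / (2 * s)` thus cover `X`. They form a locally finite family: if `J` is the finite set of all `i`
with `φ i x ≠ 0`, then the sum of the `φ i` with `i ∉ J` is continuous and vanishes at `x`. -/
theorem paracompactSpace (S : MetricCells X) : ParacompactSpace X := by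
  classical
  refine ⟨fun I U hU hUc => ?_⟩
  obtain ⟨φ, hφ⟩ := S.exists_subordinate hU hUc
  have hcont : ∀ i, Continuous fun x => φ x i := fun i =>
    S.continuous_of_char fun j => (hφ j).continuous i
  have hnonneg : ∀ x i, 0 ≤ φ x i := fun x i => by
    obtain ⟨j, d, rfl⟩ := S.surjective x
    exact (hφ j).nonneg d i
  have hmem : ∀ x i, φ x i ≠ 0 → x ∈ U i := fun x i => by
    obtain ⟨j, d, rfl⟩ := S.surjective x
    exact (hφ j).mem d i
  have hne : ∀ x, ∃ i, φ x i ≠ 0 := fun x => by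
    obtain ⟨j, d, rfl⟩ := S.surjective x
    exact (hφ j).exists_ne d
  have hfin : ∀ x, {i | φ x i ≠ 0}.Finite := fun x => by
    obtain ⟨j, d, rfl⟩ := S.surjective x
    exact (hφ j).locallyFinite.point_finite d
  let s : X → ℝ := fun x => ∑ᶠ i, φ x i
  let q : X → ℝ := fun x => ∑ᶠ i, φ x i ^ 2
  have hs : Continuous s := S.continuous_of_char fun j =>
    continuous_finsum (hφ j).continuous (hφ j).locallyFinite
  have hq : Continuous q := S.continuous_of_char fun j =>
    continuous_finsum (fun i => ((hφ j).continuous i).pow 2)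
      ((hφ j).locallyFinite.subset fun i d hd h0 => hd (by simp [h0]))
  have hs_eq : ∀ x (K : Finset I), (hfin x).toFinset ⊆ K → s x = ∑ i ∈ K, φ x i :=
    fun x K hK => finsum_eq_sum_of_support_subset _ fun i hi => hK (by simpa using hi)
  have hq_eq : ∀ x (K : Finset I), (hfin x).toFinset ⊆ K → q x = ∑ i ∈ K, φ x i ^ 2 :=
    fun x K hK => finsum_eq_sum_of_support_subset _ fun i hi => hK (by simpa using hi)
  have hqpos : ∀ x, 0 < q x := fun x => by
    obtain ⟨i, hi⟩ := hne x
    rw [hq_eq x _ subset_rfl]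
    exact Finset.sum_pos' (fun k _ => sq_nonneg _)
      ⟨i, by simpa using hi, sq_pos_of_ne_zero hi⟩
  have hspos : ∀ x, 0 < s x := fun x => by
    obtain ⟨i, hi⟩ := hne x
    rw [hs_eq x _ subset_rfl]
    exact Finset.sum_pos' (fun k _ => hnonneg x k)
      ⟨i, by simpa using hi, (hnonneg x i).lt_of_ne' hi⟩
  refine ⟨I, fun i => {x | q x < 2 * (φ x i * s x)}, fun i => ?_, ?_, fun x => ?_, fun i =>
    ⟨i, fun x hx => hmem x i fun h0 => ?_⟩⟩
  · exact isOpen_lt hq (continuous_const.mul ((hcont i).mul hs))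
  · refine eq_univ_of_forall fun x => mem_iUnion.2 ?_
    by_contra! hx
    have hx' : ∀ i, 2 * (φ x i * s x) ≤ q x := fun i => not_lt.1 (hx i)
    have h1 : 2 * (q x * s x) ≤ q x * s x := by
      calc 2 * (q x * s x) = ∑ i ∈ (hfin x).toFinset, φ x i * (2 * (φ x i * s x)) := by
            rw [hq_eq x _ subset_rfl, Finset.sum_mul, Finset.mul_sum]
            exact Finset.sum_congr rfl fun i _ => by ring
        _ ≤ ∑ i ∈ (hfin x).toFinset, φ x i * q x :=
            Finset.sum_le_sum fun i _ => mul_le_mul_of_nonneg_left (hx' i) (hnonneg x i)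
        _ = q x * s x := by rw [← Finset.sum_mul, ← hs_eq x _ subset_rfl, mul_comm]
    linarith [mul_pos (hqpos x) (hspos x)]
  · let J := (hfin x).toFinset
    have hJ : Continuous fun y => 2 * ((s y - ∑ i ∈ J, φ y i) * s y) :=
      continuous_const.mul ((hs.sub (continuous_finsetSum _ fun i _ => hcont i)).mul hs)
    refine ⟨{y | 2 * ((s y - ∑ i ∈ J, φ y i) * s y) < q y}, (isOpen_lt hJ hq).mem_nhds ?_,
      J.finite_toSet.subset ?_⟩
    · simpa [J, ← hs_eq x _ subset_rfl] using hqpos x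
    · rintro i ⟨y, hy1, hy2⟩
      by_contra hi
      have hle : φ y i + ∑ k ∈ J, φ y k ≤ s y := by
        rw [hs_eq y ((hfin y).toFinset ∪ insert i J) Finset.subset_union_left,
          ← Finset.sum_insert (fun h => hi (Finset.mem_coe.2 h))]
        exact Finset.sum_le_sum_of_subset_of_nonneg Finset.subset_union_right
          fun k _ _ => hnonneg y k
      have hmul := mul_le_mul_of_nonneg_right (le_sub_iff_add_le.2 hle) (hspos y).le
      have h1 : q y < 2 * (φ y i * s y) := hy1
      have h2 : 2 * ((s y - ∑ i ∈ J, φ y i) * s y) < q y := hy2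
      linarith
  · have h1 : q x < 2 * (φ x i * s x) := hx
    rw [h0, zero_mul, mul_zero] at h1
    exact (hqpos x).not_gt h1

theorem perfectlyNormalSpace (S : MetricCells X) : PerfectlyNormalSpace X := by
  have := S.t2Space
  have := S.paracompactSpace
  refine ⟨fun C hC => ?_⟩
  obtain ⟨f, hfc, -, hf⟩ := S.exists_continuous_zero_iff hC
  have : C = f ⁻¹' {0} := ext fun x => (hf x).symm
  rw [this]
  exact isClosed_singleton.isGδ.preimage hfc

end MetricCells

/-! ### Random simplices -/

namespace RandomSimplex

variable {Ω : Type*} [MeasurableSpace Ω] {μ : Measure Ω}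

theorem ext_rep {n : ℕ} {a b : RandomSimplex μ n} (h : ∀ᵐ ω ∂μ, a.rep ω = b.rep ω) : a = b :=
  AEEqFun.ext h

theorem rep_map {m n : ℕ} (σ : ⦋m⦌ ⟶ ⦋n⦌) (a : RandomSimplex μ m) :
    ∀ᵐ ω ∂μ, (a.map σ).rep ω = σ.toOrderHom (a.rep ω) :=
  AEEqFun.coeFn_comp _ _ _

theorem map_map {l m n : ℕ} (σ : ⦋l⦌ ⟶ ⦋m⦌) (τ : ⦋m⦌ ⟶ ⦋n⦌) (a : RandomSimplex μ l) :
    (a.map σ).map τ = a.map (σ ≫ τ) := by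
  refine ext_rep ?_
  filter_upwards [rep_map τ (a.map σ), rep_map σ a, rep_map (σ ≫ τ) a] with ω h1 h2 h3
  rw [h1, h2, h3]
  rfl

theorem map_id {n : ℕ} (a : RandomSimplex μ n) : a.map (𝟙 ⦋n⦌) = a :=
  ext_rep ((rep_map (𝟙 ⦋n⦌) a).mono fun _ h => h)

theorem map_injective {m n : ℕ} (δ : ⦋m⦌ ⟶ ⦋n⦌) [Mono δ] :
    Function.Injective (map (μ := μ) δ) := by
  intro a b h
  refine ext_rep ?_
  have h1 := rep_map δ a
  rw [h] at h1
  filter_upwards [h1, rep_map δ b] with ω h2 h3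
  exact SimplexCategory.mono_iff_injective.1 ‹Mono δ› (h2.symm.trans h3)

theorem continuous_map [IsFiniteMeasure μ] {m n : ℕ} (σ : ⦋m⦌ ⟶ ⦋n⦌) :
    Continuous (map (μ := μ) σ) := by
  refine (LipschitzWith.of_dist_le_mul (K := 1) fun a b => ?_).continuous
  rw [NNReal.coe_one, one_mul]
  refine integral_mono_ae (integrable_discrepancy _ _) (integrable_discrepancy _ _) ?_
  filter_upwards [rep_map σ a, rep_map σ b] with ω h1 h2
  by_cases h : a.rep ω = b.rep ω
  · simp [h1, h2, h]
  · simp only [h, if_false]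
    split_ifs <;> simp

/-- A random variable with values in `[n]` is full if it takes every value with positive
probability. -/
def Full {n : ℕ} (a : RandomSimplex μ n) : Prop :=
  ∀ i, ¬ ∀ᵐ ω ∂μ, a.rep ω ≠ i

theorem Full.map_of_epi {m n : ℕ} {a : RandomSimplex μ m} (ha : a.Full) (s : ⦋m⦌ ⟶ ⦋n⦌) [Epi s] :
    (a.map s).Full := by
  intro i hi
  obtain ⟨k, rfl⟩ := SimplexCategory.epi_iff_surjective.1 ‹Epi s› i
  refine ha k ?_
  filter_upwards [hi, rep_map s a] with ω h1 h2 h3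
  exact h1 (h2.trans (congrArg _ h3))

theorem full_zero [NeZero μ] (a : RandomSimplex μ 0) : a.Full := fun i hi => by
  have : ∀ᵐ ω ∂μ, False := hi.mono fun ω h => h (Subsingleton.elim (α := Fin 1) _ _)
  exact NeZero.ne μ (by simpa using this)

/-- The injection in a full factorization is determined by the random variable: its range is the set
of values taken with positive probability. -/
theorem range_eq_of_full {m n : ℕ} (δ : ⦋m⦌ ⟶ ⦋n⦌) {b : RandomSimplex μ m} (hb : b.Full) :
    range δ.toOrderHom = {i | ¬ ∀ᵐ ω ∂μ, (b.map δ).rep ω ≠ i} := by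
  ext i
  constructor
  · rintro ⟨k, rfl⟩ hk
    refine hb k ?_
    filter_upwards [hk, rep_map δ b] with ω h1 h2 h3
    exact h1 (h2.trans (congrArg _ h3))
  · intro hi
    by_contra hi'
    exact hi ((rep_map δ b).mono fun ω h1 h2 => hi' ⟨_, h1.symm.trans h2⟩)

theorem full_factorization_unique {n k k' : ℕ} {δ : ⦋k⦌ ⟶ ⦋n⦌} {δ' : ⦋k'⦌ ⟶ ⦋n⦌} [Mono δ] [Mono δ']
    {b : RandomSimplex μ k} {b' : RandomSimplex μ k'} (hb : b.Full) (hb' : b'.Full)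
    (h : b.map δ = b'.map δ') :
    (⟨k, δ, b⟩ : Σ k, (⦋k⦌ ⟶ ⦋n⦌) × RandomSimplex μ k) = ⟨k', δ', b'⟩ := by
  have hinj := SimplexCategory.mono_iff_injective.1 ‹Mono δ›
  have hinj' := SimplexCategory.mono_iff_injective.1 ‹Mono δ'›
  have hr : range δ.toOrderHom = range δ'.toOrderHom := by
    rw [range_eq_of_full δ hb, range_eq_of_full δ' hb', h]
  have hk : k = k' := by
    have h1 := Set.ncard_range_of_injective hinj
    have h2 := Set.ncard_range_of_injective hinj'
    rw [hr, h2] at h1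
    simpa using h1.symm
  subst hk
  have hδ : δ = δ' := by
    ext i : 3
    exact congrFun ((StrictMono.range_inj (δ.toOrderHom.monotone.strictMono_of_injective hinj)
      (δ'.toOrderHom.monotone.strictMono_of_injective hinj')).1 hr) i
  subst hδ
  rw [map_injective δ h]

theorem exists_retraction_δ {m : ℕ} (i : Fin (m + 2)) :
    ∃ r : ⦋m + 1⦌ ⟶ ⦋m⦌, SimplexCategory.δ i ≫ r = 𝟙 ⦋m⦌ := by
  induction i using Fin.lastCases with
  | last => exact ⟨SimplexCategory.σ (Fin.last m), SimplexCategory.δ_comp_σ_succ⟩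
  | cast i => exact ⟨SimplexCategory.σ i, SimplexCategory.δ_comp_σ_self⟩

/-- A monotone retraction of `[m + 1]` onto the face opposite to the vertex `i`. -/
def retraction {m : ℕ} (i : Fin (m + 2)) : ⦋m + 1⦌ ⟶ ⦋m⦌ := (exists_retraction_δ i).choose

theorem δ_retraction {m : ℕ} (i : Fin (m + 2)) : SimplexCategory.δ i ≫ retraction i = 𝟙 ⦋m⦌ :=
  (exists_retraction_δ i).choose_spec

/-- The face opposite to the vertex `i`, namely the random variables that avoid `i`, as the set of
fixed points of a continuous map; in particular it is closed. -/
theorem map_retraction_map_δ_iff {m : ℕ} (i : Fin (m + 2)) (a : RandomSimplex μ (m + 1)) :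
    (a.map (retraction i)).map (SimplexCategory.δ i) = a ↔ ∀ᵐ ω ∂μ, a.rep ω ≠ i := by
  constructor
  · intro h
    have h1 := rep_map (SimplexCategory.δ i) (a.map (retraction i))
    rw [h] at h1
    exact h1.mono fun ω h2 h3 => Fin.succAbove_ne i _ (h2.symm.trans h3)
  · intro h
    rw [map_map]
    refine ext_rep ?_
    filter_upwards [h, rep_map (retraction i ≫ SimplexCategory.δ i) a] with ω h1 h2
    obtain ⟨k, hk⟩ := Fin.exists_succAbove_eq h1
    have hk' : (SimplexCategory.δ i).toOrderHom k = a.rep ω := hk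
    have h3 : (retraction i).toOrderHom ((SimplexCategory.δ i).toOrderHom k) = k :=
      SimplexCategory.congr_toOrderHom_apply (δ_retraction i) k
    rw [h2, ← hk']
    exact congrArg (SimplexCategory.δ i).toOrderHom h3

theorem exists_full_factorization [NeZero μ] {n : ℕ} (a : RandomSimplex μ n) :
    ∃ (k : ℕ) (δ : ⦋k⦌ ⟶ ⦋n⦌) (b : RandomSimplex μ k), Mono δ ∧ b.Full ∧ b.map δ = a := by
  induction n with
  | zero => exact ⟨0, 𝟙 _, a, inferInstance, a.full_zero, a.map_id⟩
  | succ m ih =>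
    by_cases ha : a.Full
    · exact ⟨m + 1, 𝟙 _, a, inferInstance, ha, a.map_id⟩
    · obtain ⟨i, hi⟩ := not_forall.1 ha
      obtain ⟨k, δ, b, hδ, hb, hba⟩ := ih (a.map (retraction i))
      refine ⟨k, δ ≫ SimplexCategory.δ i, b, mono_comp _ _, hb, ?_⟩
      rw [← map_map, hba]
      exact (map_retraction_map_δ_iff i a).2 (not_not.1 hi)

end RandomSimplex

/-! ### The normal form of a point of the randomized realization -/

section NormalForm

variable {Ω : Type v} [MeasurableSpace Ω] (μ : Measure Ω) (F : SSet.{u})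

/-- The pairs of a nondegenerate simplex of `F` and a random variable with values in its set of
vertices. -/
abbrev NondegCells : Type (max u v) :=
  Σ τ : (Σ n : ℕ, F.nonDegenerate n), RandomSimplex μ τ.1

variable {μ F}

/-- `(α, a)` reduces to `(τ, s ∘ b)` if `a = δ ∘ b` with `δ` injective and `b` full, and `α δ = τ s`
with `τ` nondegenerate and `s` surjective. -/
def Reduces (c : RandomCells μ F) (p : NondegCells μ F) : Prop :=
  ∃ (k : ℕ) (δ : ⦋k⦌ ⟶ ⦋c.1⦌) (s : ⦋k⦌ ⟶ ⦋p.1.1⦌) (b : RandomSimplex μ k), Mono δ ∧ Epi s ∧ b.Full ∧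
    b.map δ = c.2.2 ∧ F.map δ.op c.2.1 = F.map s.op p.1.2.1 ∧ b.map s = p.2

theorem exists_reduces [NeZero μ] (c : RandomCells μ F) : ∃ p, Reduces c p := by
  obtain ⟨n, α, a⟩ := c
  obtain ⟨k, δ, b, hδ, hb, hba⟩ := a.exists_full_factorization
  obtain ⟨l, s, hs, τ, hτ⟩ := F.exists_nonDegenerate (F.map δ.op α)
  exact ⟨⟨⟨l, τ⟩, b.map s⟩, k, δ, s, b, hδ, hs, hb, hba, hτ, rfl⟩

/-- Uniqueness of the Eilenberg–Zilber decomposition, as an equality of pairs. -/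
theorem nondegenerate_factorization_unique {k l l' : ℕ} {s : ⦋k⦌ ⟶ ⦋l⦌} {s' : ⦋k⦌ ⟶ ⦋l'⦌} [Epi s]
    [Epi s'] {τ : F.nonDegenerate l} {τ' : F.nonDegenerate l'}
    (h : F.map s.op τ.1 = F.map s'.op τ'.1) :
    (⟨l, s, τ⟩ : Σ l, (⦋k⦌ ⟶ ⦋l⦌) × F.nonDegenerate l) = ⟨l', s', τ'⟩ := by
  have hl := F.unique_nonDegenerate_dim _ s τ rfl s' τ' h
  subst hl
  rw [F.unique_nonDegenerate_simplex _ s τ rfl s' τ' h, F.unique_nonDegenerate_map _ s τ rfl s' τ' h]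

theorem Reduces.unique {c : RandomCells μ F} {p p' : NondegCells μ F} (h : Reduces c p)
    (h' : Reduces c p') : p = p' := by
  obtain ⟨n, α, a⟩ := c
  obtain ⟨⟨l, τ⟩, (x : RandomSimplex μ l)⟩ := p
  obtain ⟨⟨l', τ'⟩, (x' : RandomSimplex μ l')⟩ := p'
  obtain ⟨k, δ, (s : ⦋k⦌ ⟶ ⦋l⦌), b, hδ, hs, hb, hba, hτ, hx⟩ := h
  obtain ⟨k', δ', (s' : ⦋k'⦌ ⟶ ⦋l'⦌), b', hδ', hs', hb', hba', hτ', hx'⟩ := h'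
  dsimp only at *
  cases RandomSimplex.full_factorization_unique hb hb' (hba.trans hba'.symm)
  cases nondegenerate_factorization_unique (hτ.symm.trans hτ')
  rw [← hx, ← hx']

/-- If `a = δ ∘ b` is the full factorization and `σ δ = ι e` is the factorization into a surjection
and an injection, then `σ ∘ a = ι ∘ (e ∘ b)` is the full factorization of `σ ∘ a`. -/
theorem Reduces.of_glue {c c' : RandomCells μ F} (h : RandomRel μ F c c') {p : NondegCells μ F}
    (hp : Reduces c p) : Reduces c' p := by
  obtain @⟨m, n, σ, α, a⟩ := h
  obtain ⟨⟨l, τ⟩, x⟩ := p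
  obtain ⟨k, δ, s, b, hδ, hs, hb, hba, hτ, hx⟩ := hp
  dsimp only at *
  obtain ⟨⟨j⟩, e, ι, he, hι, hfac⟩ : ∃ (j : SimplexCategory) (e : ⦋k⦌ ⟶ j) (ι : j ⟶ ⦋n⦌),
      Epi e ∧ Mono ι ∧ e ≫ ι = δ ≫ σ :=
    ⟨_, Limits.factorThruImage (δ ≫ σ), Limits.image.ι (δ ≫ σ), inferInstance, inferInstance,
      Limits.image.fac _⟩
  change ⦋k⦌ ⟶ ⦋j⦌ at e
  change ⦋j⦌ ⟶ ⦋n⦌ at ι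
  obtain ⟨l', t, ht, τ', hτ'⟩ := F.exists_nonDegenerate (F.map ι.op α)
  have key : F.map s.op τ.1 = F.map (e ≫ t).op τ'.1 := by
    rw [op_comp, Functor.map_comp_apply, ← hτ', ← Functor.map_comp_apply, ← op_comp, hfac, op_comp,
      Functor.map_comp_apply, hτ]
  have := epi_comp e t
  cases nondegenerate_factorization_unique key
  refine ⟨j, ι, t, b.map e, hι, ht, hb.map_of_epi e, ?_, hτ', ?_⟩
  · rw [RandomSimplex.map_map, hfac, ← hba, RandomSimplex.map_map]
  · rw [RandomSimplex.map_map, ← hx]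

/-- Identified cells have the same normal form. Reductions are transported against a generating
relation by uniqueness: the source reduces to some normal form, and so does the target. -/
theorem reduces_iff_of_eqvGen [NeZero μ] {c c' : RandomCells μ F}
    (h : Relation.EqvGen (RandomRel μ F) c c') (p : NondegCells μ F) :
    Reduces c p ↔ Reduces c' p := by
  induction h with
  | rel c c' h =>
    refine ⟨fun hp => hp.of_glue h, fun hp => ?_⟩
    obtain ⟨p', hp'⟩ := exists_reduces c
    rwa [hp.unique (hp'.of_glue h)]
  | refl => rfl
  | symm _ _ _ ih => exact ih.symm
  | trans _ _ _ _ _ ih1 ih2 => exact ih1.trans ih2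

theorem reduces_self {p : NondegCells μ F} (hp : p.2.Full) :
    Reduces (⟨p.1.1, p.1.2.1, p.2⟩ : RandomCells μ F) p :=
  ⟨p.1.1, 𝟙 _, 𝟙 _, p.2, inferInstance, inferInstance, hp, p.2.map_id, rfl, p.2.map_id⟩

namespace RandomRealization

variable (μ) in
/-- The map `L¹(Ω, [n]) → L(F)` that belongs to an `n`-simplex of `F`. -/
def char {n : ℕ} (α : F.obj (Opposite.op ⦋n⦌)) (a : RandomSimplex μ n) : RandomRealization μ F :=
  _root_.Quotient.mk (Relation.EqvGen.setoid (RandomRel μ F)) ⟨n, α, a⟩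

theorem char_map {m n : ℕ} (σ : ⦋m⦌ ⟶ ⦋n⦌) (α : F.obj (Opposite.op ⦋n⦌)) (a : RandomSimplex μ m) :
    char μ (F.map σ.op α) a = char μ α (a.map σ) :=
  _root_.Quotient.sound (.rel _ _ (.glue σ α a))

theorem eq_of_char_eq [NeZero μ] {p q : NondegCells μ F} (hp : p.2.Full) (hq : q.2.Full)
    (h : char μ p.1.2.1 p.2 = char μ q.1.2.1 q.2) : p = q :=
  ((reduces_iff_of_eqvGen (_root_.Quotient.exact h) p).1 (reduces_self hp)).unique (reduces_self hq)

theorem continuous_char [IsFiniteMeasure μ] {n : ℕ} (α : F.obj (Opposite.op ⦋n⦌)) :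
    Continuous (char μ α) := by
  let _ : ∀ n : ℕ, TopologicalSpace (F.obj (Opposite.op ⦋n⦌)) := fun _ => ⊥
  have h : Continuous fun a : RandomSimplex μ n =>
      (⟨n, (α, a)⟩ : Σ n : ℕ, F.obj (Opposite.op ⦋n⦌) × RandomSimplex μ n) :=
    continuous_sigmaMk.comp (by fun_prop)
  exact continuous_quotient_mk'.comp h

theorem isClosed_of_preimage_char [IsFiniteMeasure μ] {s : Set (RandomRealization μ F)}
    (hs : ∀ (n : ℕ) (α : F.obj (Opposite.op ⦋n⦌)), IsClosed (char μ α ⁻¹' s)) : IsClosed s := by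
  let _ : ∀ n : ℕ, TopologicalSpace (F.obj (Opposite.op ⦋n⦌)) := fun _ => ⊥
  have : ∀ n : ℕ, DiscreteTopology (F.obj (Opposite.op ⦋n⦌)) := fun _ => ⟨rfl⟩
  refine isQuotientMap_quotient_mk'.isClosed_preimage.1 ?_
  refine isClosed_sigma_iff.2 fun n => ?_
  rw [← isOpen_compl_iff, isOpen_prod_iff]
  intro α a ha
  exact ⟨{α}, char μ α ⁻¹' sᶜ, isOpen_discrete _, (hs n α).isOpen_compl, rfl, ha, by
    rintro ⟨β, b⟩ ⟨rfl, hb⟩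
    exact hb⟩

variable (μ F) in
/-- The cells of `L(F)` are the nondegenerate simplices of `F`, with domain `L¹(Ω, [n])`; the
boundary consists of the random variables that almost surely avoid a vertex. -/
def metricCells [IsProbabilityMeasure μ] : MetricCells (RandomRealization μ F) where
  Cell := Σ n : ℕ, F.nonDegenerate n
  dim τ := τ.1
  Dom τ := RandomSimplex μ τ.1
  bdry _ := {a | ¬ a.Full}
  char τ := char μ τ.2.1
  continuous_char τ := continuous_char τ.2.1
  isClosed_of_preimage s hs := isClosed_of_preimage_char fun n α => by
    obtain ⟨m, σ, -, τ, rfl⟩ := F.exists_nonDegenerate α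
    have : char μ (F.map σ.op τ.1) ⁻¹' s = RandomSimplex.map σ ⁻¹' (char μ τ.1 ⁻¹' s) :=
      ext fun a => by rw [mem_preimage, mem_preimage, mem_preimage, char_map]
    rw [this]
    exact (hs ⟨m, τ⟩).preimage (RandomSimplex.continuous_map σ)
  surjective x := by
    obtain ⟨⟨n, α, a⟩, rfl⟩ := _root_.Quotient.exists_rep x
    obtain ⟨m, σ, -, τ, rfl⟩ := F.exists_nonDegenerate α
    exact ⟨⟨m, τ⟩, a.map σ, (char_map σ τ.1 a).symm⟩
  injective p q hp hq h := eq_of_char_eq (not_not.1 hp) (not_not.1 hq) h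
  exists_faces := by
    rintro ⟨_ | m, τ⟩
    · exact ⟨Empty, inferInstance, nofun, nofun, nofun,
        (eq_empty_of_forall_notMem fun (a : RandomSimplex μ 0) (ha : ¬ a.Full) =>
          ha a.full_zero).trans (iUnion_of_empty _).symm,
        nofun⟩
    · choose l s _ τ' hτ' using fun i : Fin (m + 2) =>
        F.exists_nonDegenerate (F.map (SimplexCategory.δ i).op τ.1)
      refine ⟨Fin (m + 2), inferInstance,
        fun i => {a | (a.map (RandomSimplex.retraction i)).map (SimplexCategory.δ i) = a},
        fun i => ⟨l i, τ' i⟩, fun i a => (a.map (RandomSimplex.retraction i)).map (s i), ?_,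
        fun i => ⟨?_, ?_, ?_, fun a ha => ?_⟩⟩
      · ext a
        simp only [mem_iUnion, mem_ofPred_eq, RandomSimplex.map_retraction_map_δ_iff,
          RandomSimplex.Full, not_forall, not_not]
      · exact isClosed_eq ((RandomSimplex.continuous_map _).comp (RandomSimplex.continuous_map _))
          continuous_id
      · have := SimplexCategory.len_le_of_epi (s i)
        exact Nat.lt_succ_of_le this
      · exact (RandomSimplex.continuous_map _).comp (RandomSimplex.continuous_map _)
      · have ha' : (a.map (RandomSimplex.retraction i)).map (SimplexCategory.δ i) = a := ha
        change char μ τ.1 a = char μ (τ' i).1 _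
        rw [← char_map, ← hτ' i, char_map, ha']

theorem compactlyGeneratedSpace [IsFiniteMeasure μ] :
    CompactlyGeneratedSpace (RandomRealization μ F) := by
  let _ : ∀ n : ℕ, TopologicalSpace (F.obj (Opposite.op ⦋n⦌)) := fun _ => ⊥
  have : ∀ n : ℕ, DiscreteTopology (F.obj (Opposite.op ⦋n⦌)) := fun _ => ⟨rfl⟩
  have : SequentialSpace (RandomCells μ F) := inferInstanceAs
    (SequentialSpace (Σ n : ℕ, F.obj (Opposite.op ⦋n⦌) × RandomSimplex μ n))
  have : SequentialSpace (RandomRealization μ F) := inferInstanceAs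
    (SequentialSpace (_root_.Quotient (Relation.EqvGen.setoid (RandomRel μ F))))
  infer_instance

end RandomRealization

end NormalForm

end

theorem mainTheorem7 {Ω : Type v} [MeasurableSpace Ω] (μ : Measure Ω) [IsProbabilityMeasure μ]
    (hμ : Atomless μ) (F : SSet.{u}) :
    (T2Space (RandomRealization μ F) ∧ ParacompactSpace (RandomRealization μ F)) ∧
      PerfectlyNormalSpace (RandomRealization μ F) ∧
      CompactlyGeneratedSpace (RandomRealization μ F) :=
  let S := RandomRealization.metricCells μ F
  ⟨⟨S.t2Space, S.paracompactSpace⟩, S.perfectlyNormalSpace,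
    RandomRealization.compactlyGeneratedSpace⟩
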